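/- Let $\mathbf k$ be an algebraically closed field (of any characteristic). A tensor category over $\mathbf k$ is a $\mathbf k$-linear abelian rigid monoidal category (with $\otimes$ bilinear on morphisms) whose unit object is simple, whose morphism spaces are finite dimensional and all of whose objects have finite length. It is finite if it has finitely many simple objects $X_0,\dots,X_{n-1}$ up to isomorphism and each $X_i$ has a projective cover $P_i$; a fusion category is a semisimple finite tensor category. For an object $X$ of a finite tensor category $\mathcal C$ let $N_X$ be the matrix with entries $(N_X)_{ij}=[X\otimes X_i:X_j]$ (the multiplicity of $X_j$ in a composition series of $X\otimes X_i$). The Frobenius--Perron dimension $d_+(X)$ of $X$ is the largest nonnegative real eigenvalue of $N_X$, and the Frobenius--Perron dimension of $\mathcal C$ is $d_+(\mathcal C)=\sum_i d_+(X_i)\,d_+(P_i)$ (if $\mathcal C$ is fusion, then $P_i=X_i$ and this is $\sum_i d_+(X_i)^2$). **Theorem.** Let $\mathcal C$ be a fusion category over $\mathbf k$ such that $d_+(\mathcal C)$ is an integer. Then $d_+(X)^2$ is a nonnegative integer for every simple object $X$ of $\mathcal C$. -/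

import Mathlib

open CategoryTheory CategoryTheory.Limits MonoidalCategory

universe w v u

namespace FusionCat

section Abelian

variable {C : Type u} [Category.{v} C] [Abelian C]

/-- `HasCompositionFactors X L`: the object `X` has a composition series (a finite filtration with
simple subquotients) whose list of subquotients, from the top one to the bottom one, is `L`. -/
inductive HasCompositionFactors : C → List C → Prop
  | zero (X : C) (hX : IsZero X) : HasCompositionFactors X []
  | cons (E : ShortComplex C) (L : List C) (hE : E.ShortExact) (hS : Simple E.X₃)
      (hL : HasCompositionFactors E.X₁ L) : HasCompositionFactors E.X₂ (E.X₃ :: L)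

open Classical in
/-- The multiplicity `[X : Z]` of the simple object `Z` in the object `X` of finite length: the
number of factors isomorphic to `Z` in a composition series of `X` (it does not depend on the
series, by the Jordan-Hölder theorem). -/
noncomputable def mult (X Z : C) : ℕ :=
  if h : ∃ L : List C, HasCompositionFactors X L then
    h.choose.countP (fun Y => decide (Nonempty (Y ≅ Z)))
  else 0

/-- `π : P ⟶ X` is a projective cover: `P` is projective and `π` is an essential epimorphism. -/
structure IsProjectiveCover {P X : C} (π : P ⟶ X) : Prop where
  projective : Projective P
  epi : Epi π
  essential : ∀ {Q : C} (g : Q ⟶ P), Epi (g ≫ π) → Epi g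

attribute [local instance] Abelian.hasFiniteBiproducts

variable (C)

/-- Isomorphism of simple objects. -/
def simpleSetoid : Setoid {S : C // Simple S} :=
  (isIsomorphicSetoid C).comap Subtype.val

/-- The type of isomorphism classes of simple objects of `C`. -/
def SimpleClass : Type u := Quotient (simpleSetoid C)

/-- A finite abelian category: finitely many simple objects up to isomorphism, all objects have
finite length, and every simple object has a projective cover. -/
class IsFiniteAbelian : Prop where
  finite_simples : Finite (SimpleClass C)
  finite_length : ∀ X : C, ∃ L : List C, HasCompositionFactors X L
  exists_projectiveCover : ∀ X : C, Simple X → ∃ (P : C) (π : P ⟶ X), IsProjectiveCover π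

/-- A semisimple abelian category: every object is a finite direct sum of simple objects. -/
class IsSemisimpleAbelian : Prop where
  exists_iso_biproduct : ∀ X : C, ∃ (n : ℕ) (S : Fin n → C),
    (∀ i, Simple (S i)) ∧ Nonempty (X ≅ ⨁ S)

variable {C}

/-- A simple object representing a given isomorphism class. -/
noncomputable def SimpleClass.rep (i : SimpleClass C) : C :=
  (Quotient.out (s := simpleSetoid C) i).val

instance SimpleClass.simple_rep (i : SimpleClass C) : Simple i.rep :=
  (Quotient.out (s := simpleSetoid C) i).property

noncomputable instance [IsFiniteAbelian C] : Fintype (SimpleClass C) :=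
  haveI : Finite (SimpleClass C) := IsFiniteAbelian.finite_simples
  Fintype.ofFinite _

/-- The projective cover of the simple object representing a given isomorphism class. -/
noncomputable def SimpleClass.projCover [IsFiniteAbelian C] (i : SimpleClass C) : C :=
  (IsFiniteAbelian.exists_projectiveCover i.rep i.simple_rep).choose

end Abelian

/-- A tensor category over `k`: a `k`-linear abelian rigid monoidal category (with bilinear tensor
product) in which the unit object is simple, the spaces of morphisms are finite dimensional and all
objects have finite length. -/
class IsTensorCategory (k : Type w) [Field k] (C : Type u) [Category.{v} C] [Abelian C]
    [Linear k C] [MonoidalCategory C] [MonoidalPreadditive C] [MonoidalLinear k C]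
    [RigidCategory C] : Prop where
  simple_unit : Simple (𝟙_ C)
  finiteDimensional_hom : ∀ X Y : C, FiniteDimensional k (X ⟶ Y)
  finite_length : ∀ X : C, ∃ L : List C, HasCompositionFactors X L

/-- The largest nonnegative real eigenvalue of a real square matrix. (By the Frobenius-Perron
theorem it exists when the entries are nonnegative; there are finitely many eigenvalues, so the
supremum is a maximum.) -/
noncomputable def perronRoot {ι : Type*} [Fintype ι] (A : Matrix ι ι ℝ) : ℝ :=
  sSup {r : ℝ | 0 ≤ r ∧ Module.End.HasEigenvalue A.mulVecLin r}

section Dimension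

variable {C : Type u} [Category.{v} C] [Abelian C] [MonoidalCategory C]

/-- The matrix `N_X` of left multiplication by `X`, with entries `[X ⊗ X_i : X_j]`. -/
noncomputable def mulMatrix (X : C) : Matrix (SimpleClass C) (SimpleClass C) ℝ :=
  Matrix.of fun i j => (mult (X ⊗ i.rep) j.rep : ℝ)

/-- The Frobenius-Perron dimension `d₊(X)` of an object. -/
noncomputable def FPdim [IsFiniteAbelian C] (X : C) : ℝ :=
  perronRoot (mulMatrix X)

variable (C) in
/-- The Frobenius-Perron dimension `d₊(C) = ∑ i, d₊(X_i) d₊(P_i)` of the category, where `X_i` runs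
over the simple objects up to isomorphism and `P_i` is the projective cover of `X_i`. -/
noncomputable def FPdimCat [IsFiniteAbelian C] : ℝ :=
  ∑ i : SimpleClass C, FPdim i.rep * FPdim i.projCover

end Dimension

end FusionCat

/-!
Let `X_i` be the simple objects of the category and `d_i = d₊(X_i)`. The category is semisimple, so
the projective cover of `X_i` is `X_i` itself (`IsProjectiveCover.nonempty_iso`) and
`∑ i, d_i ^ 2 = d₊(C)` is an integer `n`.

The number `d_i` is the largest nonnegative eigenvalue of a matrix `N_i` with entries in `ℕ`. Hence
it is an algebraic integer, and by the weak form of the Perron-Frobenius theorem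
(`exists_hasEigenvalue_ge`, `norm_le_perronRoot`) every complex eigenvalue `z` of `N_i` satisfies
`‖z‖ ≤ d_i`. A Galois automorphism `σ` of the algebraic numbers maps `d_i` to another root of the
characteristic polynomial of `N_i`, so `‖σ d_i‖ ≤ d_i`. From
`∑ i, (σ d_i) ^ 2 = σ n = n = ∑ i, d_i ^ 2` it follows that `(σ d_i) ^ 2 = d_i ^ 2` for all `i`
(`sq_eq_sq_of_norm_le_of_sum_sq_eq`): the square `d_i ^ 2` is fixed by every `σ`, so it is a
rational algebraic integer (`exists_nat_sq_eq_of_sum_sq_eq_int`).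
-/

namespace FusionCat

/-! ### Nonnegative matrices -/

section Perron

open Matrix Module.End

variable {ι : Type*} [Fintype ι]

open Classical in
theorem hasEigenvalue_mulVecLin_iff (A : Matrix ι ι ℝ) (t : ℝ) :
    HasEigenvalue A.mulVecLin t ↔ A.charpoly.IsRoot t := by
  rw [hasEigenvalue_iff_isRoot_charpoly, ← Matrix.toLin'_apply', Matrix.charpoly_toLin']

/-- If a nonnegative matrix has a vector `y > 0` with `A y < s y`, then it has no nonzero vector
`x ≥ 0` with `s x ≤ A x`: compare `x` and `y` at a coordinate where `x i / y i` is maximal. -/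
theorem eq_zero_of_mulVec_lt_of_le_mulVec {A : Matrix ι ι ℝ} (hA : ∀ i j, 0 ≤ A i j) {s : ℝ}
    {x y : ι → ℝ} (hx : ∀ i, 0 ≤ x i) (hy : ∀ i, 0 < y i)
    (hxA : ∀ i, s * x i ≤ (A *ᵥ x) i) (hyA : ∀ i, (A *ᵥ y) i < s * y i) : x = 0 := by
  by_contra hne
  obtain ⟨j, hj⟩ := Function.ne_iff.mp hne
  have hxj : 0 < x j := lt_of_le_of_ne (hx j) (Ne.symm hj)
  have : Nonempty ι := ⟨j⟩
  obtain ⟨i, hi⟩ := Finite.exists_max fun i => x i / y i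
  set c := x i / y i with hc
  have hc0 : 0 < c := lt_of_lt_of_le (div_pos hxj (hy j)) (hi j)
  have hle : ∀ l, x l ≤ c * y l := fun l => (div_le_iff₀ (hy l)).mp (hi l)
  have h1 : (A *ᵥ x) i ≤ c * (A *ᵥ y) i := by
    simp only [Matrix.mulVec, dotProduct, Finset.mul_sum]
    refine Finset.sum_le_sum fun l _ => ?_
    nlinarith [mul_le_mul_of_nonneg_left (hle l) (hA i l)]
  have h2 : c * (A *ᵥ y) i < c * (s * y i) := mul_lt_mul_of_pos_left (hyA i) hc0
  have h3 : x i = c * y i := (div_mul_cancel₀ _ (hy i).ne').symm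
  have h4 := hxA i
  rw [h3] at h4
  linarith [mul_left_comm s c (y i)]

open Classical in
/-- If a nonnegative matrix `A` has no real eigenvalue in `[s, ∞)`, there is a vector `y > 0` with
`A y < s y`. The solution `y t` of `(t - A) y = 1` is positive for large `t`, depends
continuously on `t ≥ s`, and its smallest coordinate never vanishes. -/
theorem exists_pos_mulVec_lt [Nonempty ι] {A : Matrix ι ι ℝ} (hA : ∀ i j, 0 ≤ A i j) {s : ℝ}
    (hs : ∀ t, s ≤ t → ¬ HasEigenvalue A.mulVecLin t) :
    ∃ y : ι → ℝ, (∀ i, 0 < y i) ∧ ∀ i, (A *ᵥ y) i < s * y i := by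
  let B : ℝ → Matrix ι ι ℝ := fun t => t • (1 : Matrix ι ι ℝ) - A
  have hdet : ∀ t, s ≤ t → (B t).det ≠ 0 := by
    intro t ht h0
    apply hs t ht
    obtain ⟨v, hv, hv0⟩ := Matrix.exists_mulVec_eq_zero_iff.mpr h0
    refine hasEigenvalue_of_hasEigenvector (x := v) ⟨mem_eigenspace_iff.mpr ?_, hv⟩
    simp only [B, Matrix.sub_mulVec, Matrix.smul_mulVec, Matrix.one_mulVec] at hv0
    exact (sub_eq_zero.mp hv0).symm
  let y : ℝ → ι → ℝ := fun t => (B t)⁻¹ *ᵥ 1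
  have hy : ∀ t, s ≤ t → ∀ i, t * y t i = (A *ᵥ y t) i + 1 := by
    intro t ht i
    have h : B t *ᵥ y t = 1 := by
      simp only [y, Matrix.mulVec_mulVec]
      rw [Matrix.mul_nonsing_inv _ (isUnit_iff_ne_zero.mpr (hdet t ht)), Matrix.one_mulVec]
    have h' := congrFun h i
    simp only [B, Matrix.sub_mulVec, Matrix.smul_mulVec, Matrix.one_mulVec, Pi.sub_apply,
      Pi.smul_apply, smul_eq_mul, Pi.one_apply] at h'
    linarith
  have hBc : Continuous B := by fun_prop
  have hyc : ∀ i, ContinuousOn (fun t => y t i) (Set.Ici s) := by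
    intro i
    have h : ∀ t, y t i = ((B t).det)⁻¹ * ((B t).adjugate *ᵥ 1) i := by
      intro t
      simp only [y, Matrix.inv_def, Ring.inverse_eq_inv', Matrix.smul_mulVec, Pi.smul_apply,
        smul_eq_mul]
    simp only [h]
    refine ContinuousOn.mul ?_ ?_
    · exact ContinuousOn.inv₀ hBc.matrix_det.continuousOn fun t ht => hdet t ht
    · exact ((continuous_apply i).comp
        (hBc.matrix_adjugate.matrix_mulVec continuous_const)).continuousOn
  let g : ℝ → ℝ := fun t => Finset.univ.inf' Finset.univ_nonempty (y t)
  have hgc : ContinuousOn g (Set.Ici s) :=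
    ContinuousOn.finset_inf'_apply Finset.univ_nonempty fun i _ => hyc i
  have hgle : ∀ t i, g t ≤ y t i := fun t i => Finset.inf'_le _ (Finset.mem_univ i)
  have hgeq : ∀ t, ∃ i, g t = y t i := fun t => by
    obtain ⟨i, -, hi⟩ := Finset.exists_mem_eq_inf' Finset.univ_nonempty (y t)
    exact ⟨i, hi⟩
  -- The value of `A *ᵥ y` at a minimal coordinate is at least the row sum times that minimum.
  have hrow : ∀ t i, g t = y t i → (∑ j, A i j) * y t i ≤ (A *ᵥ y t) i := by
    intro t i hi
    simp only [Matrix.mulVec, dotProduct, Finset.sum_mul]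
    exact Finset.sum_le_sum fun j _ => mul_le_mul_of_nonneg_left (hi ▸ hgle t j) (hA i j)
  have hg0 : ∀ t, s ≤ t → g t ≠ 0 := by
    intro t ht h0
    obtain ⟨i, hi⟩ := hgeq t
    have h1 := hrow t i hi
    have h2 := hy t ht i
    rw [← hi, h0] at h1 h2
    linarith
  -- Beyond all row sums the minimal coordinate is positive.
  obtain ⟨T, hsT, hT⟩ : ∃ T, s ≤ T ∧ ∀ i, ∑ j, A i j < T := by
    obtain ⟨i, hi⟩ := Finite.exists_max fun i => ∑ j, A i j
    exact ⟨max s ((∑ j, A i j) + 1), le_max_left _ _, fun l =>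
      lt_of_lt_of_le (lt_of_le_of_lt (hi l) (lt_add_one _)) (le_max_right _ _)⟩
  have hgT : 0 < g T := by
    obtain ⟨i, hi⟩ := hgeq T
    have h1 := hrow T i hi
    have h2 := hy T hsT i
    rw [hi]
    refine pos_of_mul_pos_right (a := T - ∑ j, A i j) ?_ (by linarith [hT i])
    linarith
  have hgs : 0 < g s := by
    by_contra hneg
    obtain ⟨t, ht, h0⟩ := intermediate_value_Icc hsT (hgc.mono Set.Icc_subset_Ici_self)
      ⟨not_lt.mp hneg, hgT.le⟩
    exact hg0 t ht.1 h0
  refine ⟨y s, fun i => lt_of_lt_of_le hgs (hgle s i), fun i => ?_⟩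
  linarith [hy s le_rfl i]

/-- Weak form of the Perron-Frobenius theorem, for nonnegative matrices that may be reducible. -/
theorem exists_hasEigenvalue_ge {A : Matrix ι ι ℝ} (hA : ∀ i j, 0 ≤ A i j) {s : ℝ} {x : ι → ℝ}
    (hx : ∀ i, 0 ≤ x i) (hx0 : x ≠ 0) (hxA : ∀ i, s * x i ≤ (A *ᵥ x) i) :
    ∃ t, s ≤ t ∧ HasEigenvalue A.mulVecLin t := by
  by_contra! h
  obtain ⟨j, -⟩ := Function.ne_iff.mp hx0
  have : Nonempty ι := ⟨j⟩
  obtain ⟨y, hy, hyA⟩ := exists_pos_mulVec_lt hA h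
  exact hx0 (eq_zero_of_mulVec_lt_of_le_mulVec hA hx hy hxA hyA)

open Classical in
theorem exists_hasEigenvalue_norm_le {A : Matrix ι ι ℝ} (hA : ∀ i j, 0 ≤ A i j) {z : ℂ}
    (hz : (A.map (algebraMap ℝ ℂ)).charpoly.IsRoot z) :
    ∃ t, ‖z‖ ≤ t ∧ HasEigenvalue A.mulVecLin t := by
  have hz' : HasEigenvalue (Matrix.toLin' (A.map (algebraMap ℝ ℂ))) z := by
    rwa [hasEigenvalue_iff_isRoot_charpoly, Matrix.charpoly_toLin']
  obtain ⟨v, hv⟩ := hz'.exists_hasEigenvector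
  refine exists_hasEigenvalue_ge (x := fun i => ‖v i‖) hA (fun i => norm_nonneg _) ?_ ?_
  · intro h
    exact hv.2 (funext fun i => norm_eq_zero.mp (congrFun h i))
  · intro i
    have h := congrFun hv.apply_eq_smul i
    rw [Matrix.toLin'_apply, Pi.smul_apply, smul_eq_mul] at h
    rw [← norm_mul, ← h]
    simp only [Matrix.mulVec, dotProduct, Matrix.map_apply]
    refine (norm_sum_le _ _).trans (Finset.sum_le_sum fun j _ => ?_)
    simp [abs_of_nonneg (hA i j)]

theorem finite_setOf_eigenvalue (A : Matrix ι ι ℝ) :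
    {r : ℝ | 0 ≤ r ∧ HasEigenvalue A.mulVecLin r}.Finite :=
  (Module.End.finite_hasEigenvalue A.mulVecLin).subset fun _ hr => hr.2

open Classical in
/-- The supremum defining the Perron root of a nonnegative matrix is attained. -/
theorem perronRoot_mem [Nonempty ι] {A : Matrix ι ι ℝ} (hA : ∀ i j, 0 ≤ A i j) :
    0 ≤ perronRoot A ∧ HasEigenvalue A.mulVecLin (perronRoot A) := by
  have hdeg : (A.map (algebraMap ℝ ℂ)).charpoly.degree ≠ 0 := by
    rw [Matrix.charpoly_degree_eq_dim]
    exact_mod_cast Fintype.card_ne_zero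
  obtain ⟨z, hz⟩ := IsAlgClosed.exists_root _ hdeg
  obtain ⟨t, ht, hAt⟩ := exists_hasEigenvalue_norm_le hA hz
  exact Set.Nonempty.csSup_mem (s := {r : ℝ | 0 ≤ r ∧ HasEigenvalue A.mulVecLin r})
    ⟨t, (norm_nonneg z).trans ht, hAt⟩ (finite_setOf_eigenvalue A)

open Classical in
theorem norm_le_perronRoot {A : Matrix ι ι ℝ} (hA : ∀ i j, 0 ≤ A i j) {z : ℂ}
    (hz : (A.map (algebraMap ℝ ℂ)).charpoly.IsRoot z) : ‖z‖ ≤ perronRoot A := by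
  obtain ⟨t, ht, hAt⟩ := exists_hasEigenvalue_norm_le hA hz
  exact ht.trans (le_csSup (finite_setOf_eigenvalue A).bddAbove ⟨(norm_nonneg z).trans ht, hAt⟩)

end Perron

/-! ### Algebraic integers dominating their conjugates -/

section Arithmetic

open Polynomial

variable {ι : Type*} [Fintype ι]

theorem sq_eq_sq_of_norm_le_of_sum_sq_eq {d : ι → ℝ} {z : ι → ℂ} (hz : ∀ i, ‖z i‖ ≤ d i)
    (hsum : ∑ i, z i ^ 2 = ∑ i, (d i : ℂ) ^ 2) (i : ι) : z i ^ 2 = (d i : ℂ) ^ 2 := by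
  have hnorm : ∀ i, ‖z i ^ 2‖ ≤ d i ^ 2 := fun i => by
    rw [norm_pow]
    exact pow_le_pow_left₀ (norm_nonneg _) (hz i) 2
  have hre : ∀ i ∈ Finset.univ, (z i ^ 2).re ≤ d i ^ 2 := fun i _ =>
    (Complex.re_le_norm _).trans (hnorm i)
  have hsum' : ∑ i, (z i ^ 2).re = ∑ i, d i ^ 2 := by
    rw [← Complex.re_sum, hsum]
    simp only [← Complex.ofReal_pow, ← Complex.ofReal_sum, Complex.ofReal_re]
  have heq : (z i ^ 2).re = d i ^ 2 :=
    (Finset.sum_eq_sum_iff_of_le hre).mp hsum' i (Finset.mem_univ i)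
  -- A complex number whose norm is at most its real part is that real part.
  have him : (z i ^ 2).im = 0 := by
    have h1 := Complex.sq_norm (z i ^ 2)
    rw [Complex.normSq_apply, heq] at h1
    have h2 := pow_le_pow_left₀ (norm_nonneg _) (hnorm i) 2
    nlinarith
  rw [← Complex.ofReal_pow]
  exact Complex.ext (heq.trans (Complex.ofReal_re _).symm) (him.trans (Complex.ofReal_im _).symm)

/-- Real algebraic integers that dominate their conjugates and whose squares sum to an integer
have integral squares. -/
theorem exists_nat_sq_eq_of_sum_sq_eq_int {d : ι → ℝ} {p : ι → ℤ[X]} (hp : ∀ i, (p i).Monic)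
    (hpd : ∀ i, aeval (d i) (p i) = 0) (hdom : ∀ i (z : ℂ), aeval z (p i) = 0 → ‖z‖ ≤ d i)
    {n : ℤ} (hn : ∑ i, d i ^ 2 = n) (i : ι) : ∃ m : ℕ, d i ^ 2 = m := by
  let L := algebraicClosure ℚ ℂ
  have hpc : ∀ i, aeval (d i : ℂ) (p i) = 0 := fun i => by
    have h := aeval_algebraMap_apply ℂ (d i) (p i)
    rw [hpd i, map_zero] at h
    exact h
  have hint : ∀ i, IsIntegral ℤ (d i : ℂ) := fun i => ⟨p i, hp i, hpc i⟩
  have hL : ∀ i, (d i : ℂ) ∈ L := fun i =>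
    mem_algebraicClosure_iff.mpr (hint i).tower_top.isAlgebraic
  let a : ι → L := fun i => ⟨d i, hL i⟩
  have hpa : ∀ i, aeval (a i) (p i) = 0 := fun i => by
    apply (algebraMap L ℂ).injective
    rw [← aeval_algebraMap_apply, map_zero]
    exact hpc i
  have hna : ∑ i, a i ^ 2 = (n : L) := by
    apply (algebraMap L ℂ).injective
    rw [map_sum, map_intCast]
    have h : ((∑ i, d i ^ 2 : ℝ) : ℂ) = n := by rw [hn]; simp
    rw [← h]
    push_cast
    rfl
  have : IsAlgClosure ℚ L := algebraicClosure.isAlgClosure ℚ ℂ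
  have : Normal ℚ L := IsAlgClosure.normal ℚ L
  have : IsGalois ℚ L := {}
  have hfix : ∀ σ : L ≃ₐ[ℚ] L, σ (a i ^ 2) = a i ^ 2 := by
    intro σ
    have hroot : ∀ j, aeval ((σ (a j) : L) : ℂ) (p j) = 0 := fun j => by
      have h : aeval (σ (a j)) (p j) = 0 := by
        have h := aeval_algHom_apply (σ.toAlgHom.restrictScalars ℤ) (a j) (p j)
        rw [hpa j, map_zero] at h
        exact h
      have h' := aeval_algebraMap_apply ℂ (σ (a j)) (p j)
      rw [h, map_zero] at h'
      exact h'
    have hsum : ∑ j, ((σ (a j) : L) : ℂ) ^ 2 = ∑ j, (d j : ℂ) ^ 2 := by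
      have h : σ (∑ j, a j ^ 2) = ∑ j, a j ^ 2 := by rw [hna, map_intCast]
      have h' := congrArg (algebraMap L ℂ) h
      simp only [map_sum, map_pow] at h'
      exact h'
    have h := sq_eq_sq_of_norm_le_of_sum_sq_eq (fun j => hdom j _ (hroot j)) hsum i
    apply (algebraMap L ℂ).injective
    rw [map_pow, map_pow, map_pow]
    exact h
  obtain ⟨q, hq⟩ := IntermediateField.mem_bot.mp ((InfiniteGalois.mem_bot_iff_fixed _).mpr hfix)
  have hqc : (q : ℂ) = (d i : ℂ) ^ 2 := by
    have h := congrArg (algebraMap L ℂ) hq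
    rw [map_pow, ← IsScalarTower.algebraMap_apply] at h
    exact h
  have hqint : IsIntegral ℤ q := by
    rw [← isIntegral_algebraMap_iff (algebraMap ℚ ℂ).injective]
    have h := (hint i).pow 2
    rw [← hqc] at h
    exact h
  obtain ⟨m, hm⟩ := IsIntegrallyClosed.isIntegral_iff.mp hqint
  have hmd : (m : ℝ) = d i ^ 2 := by
    have h : ((m : ℝ) : ℂ) = ((d i ^ 2 : ℝ) : ℂ) := by
      push_cast
      rw [← hqc, ← hm]
      simp
    exact Complex.ofReal_injective h
  have hm0 : 0 ≤ m := by
    have h : (0 : ℝ) ≤ m := hmd ▸ sq_nonneg _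
    exact_mod_cast h
  lift m to ℕ using hm0
  exact ⟨m, by rw [← hmd]; simp⟩

open Classical in
/-- If the squares of the Perron roots of finitely many matrices over `ℕ` sum to an integer, each of
these squares is an integer. -/
theorem exists_nat_perronRoot_sq_eq {κ : Type*} [Fintype κ] [Nonempty κ] {M : ι → Matrix κ κ ℕ}
    {n : ℤ} (hn : ∑ i, perronRoot ((M i).map (Nat.cast : ℕ → ℝ)) ^ 2 = n) (i : ι) :
    ∃ m : ℕ, perronRoot ((M i).map (Nat.cast : ℕ → ℝ)) ^ 2 = m := by
  let A : ι → Matrix κ κ ℝ := fun i => (M i).map (Nat.cast : ℕ → ℝ)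
  let Z : ι → Matrix κ κ ℤ := fun i => (M i).map (Nat.cast : ℕ → ℤ)
  have hA : ∀ i j l, 0 ≤ A i j l := fun i j l => Nat.cast_nonneg _
  have hZA : ∀ i, (Z i).map (algebraMap ℤ ℝ) = A i := fun i => by
    ext j l
    simp [Z, A]
  have hZC : ∀ i, (Z i).map (algebraMap ℤ ℂ) = (A i).map (algebraMap ℝ ℂ) := fun i => by
    ext j l
    simp [Z, A]
  refine exists_nat_sq_eq_of_sum_sq_eq_int (p := fun i => (Z i).charpoly)
    (fun i => Matrix.charpoly_monic _) (fun i => ?_) (fun i z hz => ?_) hn i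
  · have h := (hasEigenvalue_mulVecLin_iff _ _).mp (perronRoot_mem (hA i)).2
    rw [← hZA, Matrix.charpoly_map, IsRoot, eval_map_algebraMap, hZA] at h
    exact h
  · refine norm_le_perronRoot (hA i) ?_
    rwa [← hZC, Matrix.charpoly_map, IsRoot, eval_map_algebraMap]

end Arithmetic

/-! ### Dimensions of isomorphic objects and projective covers -/

section Category

variable {C : Type u} [Category.{v} C] [Abelian C]

theorem HasCompositionFactors.of_iso {X Y : C} (e : X ≅ Y) {L : List C}
    (h : HasCompositionFactors X L) : HasCompositionFactors Y L := by
  cases h with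
  | zero _ hX => exact .zero Y (hX.of_iso e.symm)
  | cons E L hE hS hL =>
    refine .cons (ShortComplex.mk (E.f ≫ e.hom) (e.inv ≫ E.g) (by simp)) L ?_ hS hL
    exact ShortComplex.shortExact_of_iso (S₁ := E)
      (ShortComplex.isoMk (Iso.refl _) e (Iso.refl _) (by simp) (by simp)) hE

theorem mult_eq_of_iso {X Y : C} (e : X ≅ Y) (Z : C) : mult X Z = mult Y Z := by
  have h : HasCompositionFactors X = HasCompositionFactors Y :=
    funext fun _ => propext ⟨.of_iso e, .of_iso e.symm⟩
  unfold mult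
  rw [h]

theorem FPdim_eq_of_iso [MonoidalCategory C] [IsFiniteAbelian C] {X Y : C} (e : X ≅ Y) :
    FPdim X = FPdim Y := by
  have h : mulMatrix X = mulMatrix Y := by
    ext i j
    simp only [mulMatrix, Matrix.of_apply]
    rw [mult_eq_of_iso (whiskerRightIso e i.rep)]
  rw [FPdim, FPdim, h]

theorem mulMatrix_eq_map_natCast [MonoidalCategory C] (X : C) :
    mulMatrix X =
      (Matrix.of fun i j : SimpleClass C => mult (X ⊗ i.rep) j.rep).map (Nat.cast : ℕ → ℝ) :=
  rfl

theorem SimpleClass.exists_rep_iso (X : C) (hX : Simple X) :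
    ∃ i : SimpleClass C, Nonempty (i.rep ≅ X) :=
  ⟨Quotient.mk (simpleSetoid C) ⟨X, hX⟩, Quotient.mk_out (s := simpleSetoid C) ⟨X, hX⟩⟩

attribute [local instance] Abelian.hasFiniteBiproducts

/-- In a semisimple category the projective cover of a simple object `S` is `S` itself: some simple
summand of the cover maps isomorphically onto `S`, and it is all of the cover because the cover is
essential. -/
theorem IsProjectiveCover.nonempty_iso [IsSemisimpleAbelian C] {P S : C} {π : P ⟶ S}
    (hπ : IsProjectiveCover π) (hS : Simple S) : Nonempty (P ≅ S) := by
  obtain ⟨n, T, hT, ⟨e⟩⟩ := IsSemisimpleAbelian.exists_iso_biproduct P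
  have := hπ.epi
  have hπ0 : π ≠ 0 := by
    rintro rfl
    exact Simple.not_isZero S (IsZero.of_epi_eq_zero (0 : P ⟶ S) rfl)
  obtain ⟨j, hj⟩ : ∃ j, (biproduct.ι T j ≫ e.inv) ≫ π ≠ 0 := by
    by_contra! h
    refine hπ0 ?_
    rw [← cancel_epi e.inv, comp_zero]
    refine biproduct.hom_ext' _ _ fun j => ?_
    rw [comp_zero, ← Category.assoc, h j]
  have := hT j
  have : IsIso ((biproduct.ι T j ≫ e.inv) ≫ π) := isIso_of_hom_simple hj
  have : Epi (biproduct.ι T j ≫ e.inv) := hπ.essential _ inferInstance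
  have : IsIso (biproduct.ι T j ≫ e.inv) := isIso_of_mono_of_epi _
  exact ⟨(asIso (biproduct.ι T j ≫ e.inv)).symm ≪≫ asIso ((biproduct.ι T j ≫ e.inv) ≫ π)⟩

theorem SimpleClass.nonempty_projCover_iso [IsFiniteAbelian C] [IsSemisimpleAbelian C]
    (i : SimpleClass C) : Nonempty (i.projCover ≅ i.rep) :=
  (IsFiniteAbelian.exists_projectiveCover i.rep i.simple_rep).choose_spec.choose_spec.nonempty_iso
    i.simple_rep

theorem FPdimCat_eq_sum_sq [MonoidalCategory C] [IsFiniteAbelian C] [IsSemisimpleAbelian C] :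
    FPdimCat C = ∑ i : SimpleClass C, FPdim i.rep ^ 2 := by
  refine Finset.sum_congr rfl fun i _ => ?_
  obtain ⟨e⟩ := i.nonempty_projCover_iso
  rw [FPdim_eq_of_iso e, sq]

end Category

end FusionCat
open FusionCat in
theorem mainTheorem9 {k : Type w} [Field k] [IsAlgClosed k]
    {C : Type u} [Category.{v} C] [Abelian C] [Linear k C]
    [MonoidalCategory C] [MonoidalPreadditive C] [MonoidalLinear k C] [RigidCategory C]
    [IsTensorCategory k C] [IsFiniteAbelian C] [IsSemisimpleAbelian C]
    (hC : ∃ n : ℤ, FPdimCat C = n) (X : C) (hX : Simple X) :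
    ∃ m : ℕ, FPdim X ^ 2 = m := by
  obtain ⟨n, hn⟩ := hC
  obtain ⟨i, ⟨e⟩⟩ := SimpleClass.exists_rep_iso X hX
  have : Nonempty (SimpleClass C) := ⟨i⟩
  rw [FPdimCat_eq_sum_sq] at hn
  rw [← FPdim_eq_of_iso e]
  simp only [FPdim, mulMatrix_eq_map_natCast] at hn ⊢
  exact exists_nat_perronRoot_sq_eq hn i
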